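/- **Setting.** Let $F$ be a finite field and let data be measured in symbols of $F$. A linear exact-repair $(n,k,d,e,\alpha,\beta)$ code ($k\le d\le n-e$) for a file of $\mathcal M$ symbols consists of $n$ nodes, each storing $\alpha$ symbols that depend linearly on the file, such that (i) any $k$ nodes determine the file, and (ii) whenever any $e$ nodes fail, and for any $d$ surviving helper nodes, each helper can send $\beta$ linear combinations of its own symbols to a central node that recovers exactly the contents of all $e$ failed nodes from them. A pair $(\alpha,\beta)$ of nonnegative reals is *admissible* (on or above the functional storage-bandwidth tradeoff) if $$\mathcal M\le \sum_{i=1}^{g}\min\Big(u_i\alpha,\ \big(d-\textstyle\sum_{j<i}u_j\big)\beta\Big)$$ for every sequence of integers $u_1,\dots,u_g$ with $1\le u_i\le e$ and $\sum_i u_i=k$. The minimum storage multi-node repair (MSMR) point is the admissible pair with the least possible $\alpha$ and, for this $\alpha$, the least possible $\beta$; for $1\le e\le k$ it is $\alpha=\mathcal M/k$, $d\beta=\frac{\mathcal M}{k}\cdot\frac{ed}{d-k+e}$. An MSMR code is a code as above whose $(\alpha,\beta)$ is the MSMR point; its repair is then said to be optimal. **Interference alignment codes.** Let $V=[\mathbf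 v_1,\dots,\mathbf v_k]$ be an invertible $k\times k$ matrix over $F$, $V'=(V^{-1})^t$ with columns $\mathbf v'_i$, let $P$ be a $k\times k$ matrix over $F$ all of whose square submatrices are invertible, let $\kappa\in F$ with $\kappa\ne0$ and $\kappa^2\neq1$, and let $U=\kappa^{-1}V'P$ with columns $\mathbf u_i$. The associated interference alignment code has $n=2k$ nodes and file $(\mathbf w_1,\dots,\mathbf w_k)\in(F^k)^k$, so $\mathcal M=k^2$; systematic node $l\in[k]$ stores $\mathbf w_l$, and parity node $i\in[k]$ stores $$\bar{\mathbf w}_i^{\,t}=\sum_{j=1}^k\mathbf w_j^{\,t}\big(\mathbf u_i\mathbf v_j^{\,t}+P_{j,i}I\big).$$ In the repair of a single node, each other node, with content $\mathbf x$, sends the one symbol $\mathbf x^t\mathbf v'_l$ if systematic node $l$ failed, and $\mathbf x^t\mathbf u_l$ if parity node $l$ failed. **Theorem.** For every $k$ there is a number $q_0=q_0(k)$ such that over every finite field $F$ with $|F|\ge q_0$ there exist $V,P,\kappa$ as above for which the associated interference alignment code is, simultaneously for every $1\le e\le k$, a $(2k,k,2k-e,e,k,e)$ MSMR code. Moreover,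 for every set of $e$ failed nodes, systematic and parity nodes in any combination, the contents of all failed nodes are linear functions of the $e(2k-e)$ symbols obtained when each of the $2k-e$ surviving nodes sends, for each failed node, just the one symbol that it sends in the single-node repair of that node. Hence any $e\le k$ erasures are repaired with optimal bandwidth. -/

import Mathlib

open scoped Matrix

namespace RegeneratingCode

/-! Centralized multi-node repair: functional tradeoff and its minimum storage point. -/

/-- A recovery scenario: a finite sequence `u = [u₁, …, u_g]` with `1 ≤ uᵢ ≤ e` and sum `k`. -/
def IsScenario (k e : ℕ) (u : List ℕ) : Prop :=
  (∀ x ∈ u, 1 ≤ x ∧ x ≤ e) ∧ u.sum = k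

/-- The cut value `f(u) = ∑ᵢ min (uᵢ α, (d - ∑_{j < i} uⱼ) β)` of a scenario. -/
noncomputable def scenarioCut (d : ℕ) (α β : ℝ) (u : List ℕ) : ℝ :=
  ∑ i : Fin u.length,
    min ((u.get i : ℝ) * α) (((d : ℝ) - ((u.take i).sum : ℝ)) * β)

/-- The pair `(α, β)` lies in the admissible region of the functional storage-bandwidth
tradeoff for a file of size `M`: the file size is at most the cut value of every scenario. -/
def FunctionalFeasible (M : ℝ) (k d e : ℕ) (α β : ℝ) : Prop :=
  0 ≤ α ∧ 0 ≤ β ∧ ∀ u : List ℕ, IsScenario k e u → M ≤ scenarioCut d α β u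

/-- The minimum storage multi-node repair (MSMR) point of the functional tradeoff: the storage
`α` is the least admissible one, and the bandwidth `β` is the least admissible one for it. -/
def IsMSMRPoint (M : ℝ) (k d e : ℕ) (α β : ℝ) : Prop :=
  IsLeast {a : ℝ | ∃ b : ℝ, FunctionalFeasible M k d e a b} α ∧
    IsLeast {b : ℝ | FunctionalFeasible M k d e α b} β

section Codes

variable {F : Type*} [Field F] {N : Type*} {W : Type*} [AddCommGroup W] [Module F W] {α : ℕ}

/-- Reconstruction property of a linear storage code, in which node `i` stores the `α` symbols
`C i w` of the file `w`: any `k` nodes determine the file. -/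
def HasReconstruction (C : N → W →ₗ[F] (Fin α → F)) (k : ℕ) : Prop :=
  ∀ S : Finset N, S.card = k →
    ∃ dec : ((i : {i // i ∈ S}) → Fin α → F) →ₗ[F] W,
      ∀ w : W, dec (fun i => C i.1 w) = w

/-- Exact centralized repair of the failed nodes `E` from the helpers `H`, each helper sending
`β` symbols computed from its own content. -/
def ExactRepair (C : N → W →ₗ[F] (Fin α → F)) (E H : Finset N) (β : ℕ) : Prop :=
  ∃ (send : {h // h ∈ H} → (Fin α → F) →ₗ[F] (Fin β → F))
    (rep : ({h // h ∈ H} → Fin β → F) →ₗ[F] ({f // f ∈ E} → Fin α → F)),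
    ∀ w : W, rep (fun h => send h (C h.1 w)) = fun f => C f.1 w

/-- `C` is a linear exact-repair `(n, k, d, e, α, β)` MSMR code: it has `n` nodes storing `α`
symbols each, it has the reconstruction property, any `e` failed nodes are repaired exactly from
any `d` other nodes that send `β` symbols each, and `(α, β)` is the MSMR point for the file size
`M = dim W`. -/
structure IsMSMRCode [Fintype N] (n k d e α β : ℕ) (C : N → W →ₗ[F] (Fin α → F)) : Prop where
  card_nodes : Fintype.card N = n
  k_le_d : k ≤ d
  d_add_e_le : d + e ≤ n
  reconstruction : HasReconstruction C k
  regeneration : ∀ E H : Finset N, E.card = e → H.card = d → Disjoint E H →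
    ExactRepair C E H β
  msmr_point : IsMSMRPoint (Module.finrank F W : ℝ) k d e (α : ℝ) (β : ℝ)

end Codes

/-! Interference alignment codes. -/

/-- The parameters of an interference alignment code: linearly independent vectors
`v₁, …, v_k` (the columns of `V`), a matrix `P` all of whose square submatrices are invertible,
and a constant `κ` with `κ ≠ 0` and `κ ^ 2 ≠ 1`. -/
structure IACode (k : ℕ) (F : Type*) [Field F] where
  V : Matrix (Fin k) (Fin k) F
  P : Matrix (Fin k) (Fin k) F
  κ : F
  linearIndependent_V : LinearIndependent F (fun i : Fin k => Vᵀ i)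
  submatrix_P : ∀ (m : ℕ) (r c : Fin m ↪ Fin k), IsUnit (P.submatrix r c)
  κ_ne_zero : κ ≠ 0
  κ_sq_sub_one_ne_zero : κ ^ 2 - 1 ≠ 0

namespace IACode

variable {k : ℕ} {F : Type*} [Field F] (D : IACode k F)

/-- The inverse transpose of `V`, whose columns are the dual basis of the columns of `V`. -/
noncomputable def dualV : Matrix (Fin k) (Fin k) F := (D.V⁻¹)ᵀ

/-- `U = κ⁻¹ V' P`. -/
noncomputable def U : Matrix (Fin k) (Fin k) F := D.κ⁻¹ • (D.dualV * D.P)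

/-- The encoding submatrix `G_j^{(i)} = uᵢ vⱼᵗ + P_{j,i} I` of parity node `i` for the
information unit `j`. -/
noncomputable def G (j i : Fin k) : Matrix (Fin k) (Fin k) F :=
  Matrix.vecMulVec (fun a => D.U a i) (fun a => D.V a j) + D.P j i • 1

/-- The content of a node as a function of the file `w = (w₁, …, w_k)`: systematic node `l`
(`Sum.inl l`) stores `w_l`, and parity node `i` (`Sum.inr i`) stores `∑ⱼ wⱼᵗ G_j^{(i)}`. -/
noncomputable def node :
    Fin k ⊕ Fin k → (Fin k → Fin k → F) →ₗ[F] (Fin k → F)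
  | Sum.inl l => LinearMap.proj l
  | Sum.inr i => ∑ j : Fin k, (Matrix.vecMulLinear (D.G j i)).comp (LinearMap.proj j)

/-- The vector on which every other node projects its content in the repair of a single node:
`v'_l` for systematic node `l` and `u_l` for parity node `l`. -/
noncomputable def repairVector : Fin k ⊕ Fin k → Fin k → F
  | Sum.inl l => fun a => D.dualV a l
  | Sum.inr l => fun a => D.U a l

/-- The symbol that node `h` sends for the repair of node `f`. -/
noncomputable def repairSymbol (h f : Fin k ⊕ Fin k) (w : Fin k → Fin k → F) : F :=
  D.node h w ⬝ᵥ D.repairVector f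

/-- The failed nodes `E` are jointly recovered, by a linear map, when every surviving node sends
for each failed node just the one symbol that it sends in the repair of that single node. -/
def RepairsFromSingleNodeSymbols (E : Finset (Fin k ⊕ Fin k)) : Prop :=
  ∃ rep : ({h // h ∉ E} → {f // f ∈ E} → F) →ₗ[F] ({f // f ∈ E} → Fin k → F),
    ∀ w : Fin k → Fin k → F,
      rep (fun h f => D.repairSymbol h.1 f.1 w) = fun f => D.node f.1 w

end IACode

end RegeneratingCode

namespace RegeneratingCode

/-! Linear maps determined by kernels. -/

/-! Take `V = 1` and write the file as a matrix `A` with rows `w_l`. Systematic nodes hold the rows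
of `A`, parity nodes the rows of `Pᵀ(A + cAᵀ)` with `c = κ⁻¹`. By linearity
(`exists_linearMap_factor`), decoding amounts to showing that if all transmitted symbols vanish, so
do the failed contents.

Let `S`, `T` be the failed systematic and parity nodes, `p` and `τ` their coordinate projections and
`r = PτP⁻¹`. Vanishing symbols become identities between `A`, `p`, `r` and transposes, and
`projections_repair` solves them once `1 - prp` is invertible and `c² ≠ 1`.

For each `S`, `T` with `|S| + |T| ≤ k`, invertibility follows from the nonvanishing of an integral
polynomial in the entries of `P`, which some permutation matrix witnesses over every field. The
minors of `P` behave likewise, so over large fields one `P` serves all conditions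
(`exists_generic_matrix`). Reconstruction is the repair of the complement of `k` nodes, and
`isMSMRPoint_minimum_storage` checks optimality. -/

theorem exists_linearMap_factor {K V₁ V₂ V₃ : Type*} [Field K] [AddCommGroup V₁] [Module K V₁]
    [AddCommGroup V₂] [Module K V₂] [AddCommGroup V₃] [Module K V₃]
    (f : V₁ →ₗ[K] V₂) (g : V₁ →ₗ[K] V₃) (h : ∀ v, f v = 0 → g v = 0) :
    ∃ r : V₂ →ₗ[K] V₃, ∀ v, r (f v) = g v := by
  have hle : LinearMap.ker f ≤ LinearMap.ker g := fun v hv => h v hv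
  obtain ⟨s, hs⟩ := f.rangeRestrict.exists_rightInverse_of_surjective f.range_rangeRestrict
  obtain ⟨r, hr⟩ := LinearMap.exists_extend (g.comp s)
  refine ⟨r, fun v => ?_⟩
  have h1 : r (f v) = g (s (f.rangeRestrict v)) := LinearMap.congr_fun hr (f.rangeRestrict v)
  have h2 : f (s (f.rangeRestrict v)) = f v :=
    congrArg Subtype.val (LinearMap.congr_fun hs (f.rangeRestrict v))
  rw [h1, ← sub_eq_zero, ← map_sub]
  exact h _ (by rw [map_sub, h2, sub_self])

/-! Simultaneous nonvanishing of integral polynomials over large finite fields. -/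

universe u

theorem exists_common_nonzero {σ ι : Type*} [Finite σ] [Fintype ι]
    (Φ : ι → MvPolynomial σ ℤ) :
    ∃ q₀ : ℕ, ∀ (F : Type u) [Field F] [Finite F], q₀ ≤ Nat.card F →
      (∀ i, ∃ x : σ → F, MvPolynomial.aeval x (Φ i) ≠ 0) →
      ∃ x : σ → F, ∀ i, MvPolynomial.aeval x (Φ i) ≠ 0 := by
  -- The degree of the integral product bounds that of every reduction, so the threshold does not
  -- depend on the characteristic.
  refine ⟨(∏ i, Φ i).totalDegree + 1, fun F _ _ hF hΦ => ?_⟩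
  have := Fintype.ofFinite F
  have heval : ∀ (p : MvPolynomial σ ℤ) (x : σ → F),
      MvPolynomial.eval x (MvPolynomial.map (Int.castRingHom F) p) = MvPolynomial.aeval x p := by
    intro p x
    rw [MvPolynomial.eval_map, MvPolynomial.aeval_def]
    rfl
  have hne : MvPolynomial.map (Int.castRingHom F) (∏ i, Φ i) ≠ 0 := by
    rw [map_prod]
    refine Finset.prod_ne_zero_iff.2 fun i _ h0 => ?_
    obtain ⟨x, hx⟩ := hΦ i
    rw [← heval, h0] at hx
    simp at hx
  by_contra! hcon
  refine hne (MvPolynomial.eq_zero_of_eval_zero_at_prod_finset _ (fun _ => Finset.univ)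
    (fun i => ?_) fun x _ => ?_)
  · rw [Finset.card_univ, ← Nat.card_eq_fintype_card]
    refine lt_of_le_of_lt (MvPolynomial.degreeOf_le_totalDegree _ i) (lt_of_le_of_lt ?_ hF)
    exact Finset.sup_mono (MvPolynomial.support_map_subset _ _)
  · obtain ⟨i, hi⟩ := hcon x
    rw [heval, map_prod]
    exact Finset.prod_eq_zero (Finset.mem_univ i) hi

/-! ### Coordinate projections and the repair determinant. -/

section CoordProj

variable {n R : Type*} [DecidableEq n] [CommRing R]

/-- The diagonal matrix that projects onto the coordinates in `S`. -/
def coordProj (R : Type*) [CommRing R] (S : Finset n) : Matrix n n R :=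
  Matrix.diagonal fun i => if i ∈ S then 1 else 0

theorem permMatrix_apply (σ : Equiv.Perm n) (i j : n) :
    σ.permMatrix R i j = if σ i = j then 1 else 0 := by
  simp [Equiv.Perm.permMatrix, PEquiv.toMatrix_apply]

theorem coordProj_transpose (S : Finset n) : (coordProj R S)ᵀ = coordProj R S :=
  Matrix.diagonal_transpose _

theorem map_coordProj {R' : Type*} [CommRing R'] (f : R →+* R') (S : Finset n) :
    (coordProj R S).map f = coordProj R' S := by
  ext i j
  by_cases hij : i = j
  · subst hij
    simp [coordProj, apply_ite f]
  · simp [coordProj, hij]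

variable [Fintype n]

theorem coordProj_mul_apply (S : Finset n) (M : Matrix n n R) (i j : n) :
    (coordProj R S * M) i j = if i ∈ S then M i j else 0 := by
  simp [coordProj, Matrix.diagonal_mul]

theorem mul_coordProj_apply (S : Finset n) (M : Matrix n n R) (i j : n) :
    (M * coordProj R S) i j = if j ∈ S then M i j else 0 := by
  simp [coordProj, Matrix.mul_diagonal]

theorem coordProj_mul_self (S : Finset n) : coordProj R S * coordProj R S = coordProj R S := by
  ext i j
  rw [coordProj_mul_apply]
  by_cases hi : i ∈ S <;> simp [coordProj, hi, Matrix.diagonal_apply]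

/-- A denominator-free form of `det (1 - π P τ P⁻¹ π)`, where `π` and `τ` are the coordinate
projections for `S` and `T`. -/
noncomputable def repairDet (S T : Finset n) (M : Matrix n n R) : R :=
  (M.det • (1 : Matrix n n R) -
    coordProj R S * M * coordProj R T * M.adjugate * coordProj R S).det

theorem map_repairDet {R' : Type*} [CommRing R'] (f : R →+* R') (S T : Finset n)
    (M : Matrix n n R) : f (repairDet S T M) = repairDet S T (f.mapMatrix M) := by
  have hπ : ∀ S : Finset n, f.mapMatrix (coordProj R S) = coordProj R' S := map_coordProj f
  rw [repairDet, repairDet, RingHom.map_det, map_sub, map_mul, map_mul, map_mul, map_mul,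
    hπ, hπ, RingHom.map_adjugate, ← RingHom.map_det]
  congr 2
  ext i j
  by_cases hij : i = j <;> simp [hij]

theorem isUnit_of_repairDet_ne_zero {K : Type*} [Field K] (S T : Finset n) (P : Matrix n n K)
    (hP : P.det ≠ 0) (h : repairDet S T P ≠ 0) :
    IsUnit (1 - coordProj K S * P * coordProj K T * P⁻¹ * coordProj K S) := by
  rw [Matrix.isUnit_iff_isUnit_det, isUnit_iff_ne_zero]
  intro h0
  apply h
  have : P.det • (1 : Matrix n n K) -
      coordProj K S * P * coordProj K T * P.adjugate * coordProj K S =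
      P.det • (1 - coordProj K S * P * coordProj K T * P⁻¹ * coordProj K S) := by
    rw [Matrix.inv_def, Ring.inverse_eq_inv', smul_sub, Matrix.mul_smul, Matrix.smul_mul,
      smul_smul, mul_inv_cancel₀ hP, one_smul]
  rw [repairDet, this, Matrix.det_smul, h0, mul_zero]

/-- If `σ` moves `S` off `T`, the product `π P τ` vanishes, leaving a power of `det P = ±1`. -/
theorem repairDet_permMatrix_ne_zero [IsDomain R] (S T : Finset n)
    (σ : Equiv.Perm n) (h : ∀ i ∈ S, σ i ∉ T) : repairDet S T (σ.permMatrix R) ≠ 0 := by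
  have h0 : coordProj R S * σ.permMatrix R * coordProj R T = 0 := by
    ext i j
    rw [mul_coordProj_apply, coordProj_mul_apply, permMatrix_apply]
    have h1 : j ∈ T → i ∈ S → σ i ≠ j := fun hj hi hh => h i hi (hh ▸ hj)
    simp only [Matrix.zero_apply]
    split_ifs <;> simp_all
  rw [repairDet, h0, Matrix.zero_mul, Matrix.zero_mul, sub_zero, Matrix.det_smul, Matrix.det_one,
    mul_one, Matrix.det_permutation]
  rcases Int.units_eq_one_or (Equiv.Perm.sign σ) with hs | hs <;> simp [hs]

end CoordProj

/-! ### A generic matrix over every large finite field. -/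

theorem exists_generic_matrix (k : ℕ) :
    ∃ q₀ : ℕ, ∀ (F : Type u) [Field F] [Finite F], q₀ ≤ Nat.card F →
      ∃ P : Matrix (Fin k) (Fin k) F,
        (∀ (m : ℕ) (r c : Fin m ↪ Fin k), IsUnit (P.submatrix r c)) ∧
        ∀ S T : Finset (Fin k), S.card + T.card ≤ k →
          IsUnit (1 - coordProj F S * P * coordProj F T * P⁻¹ * coordProj F S) := by
  let X := Matrix.mvPolynomialX (Fin k) (Fin k) ℤ
  let Φ : (Σ m : Fin (k + 1), (Fin m ↪ Fin k) × (Fin m ↪ Fin k)) ⊕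
      {p : Finset (Fin k) × Finset (Fin k) // p.1.card + p.2.card ≤ k} →
      MvPolynomial (Fin k × Fin k) ℤ :=
    Sum.elim (fun i => (X.submatrix i.2.1 i.2.2).det) (fun p => repairDet p.1.1 p.1.2 X)
  obtain ⟨q₀, hq⟩ := exists_common_nonzero.{u} Φ
  refine ⟨q₀, fun F _ _ hF => ?_⟩
  have hX : ∀ P : Matrix (Fin k) (Fin k) F,
      ((MvPolynomial.aeval fun p : Fin k × Fin k => P p.1 p.2 :
        MvPolynomial (Fin k × Fin k) ℤ →ₐ[ℤ] F) : MvPolynomial (Fin k × Fin k) ℤ →+* F).mapMatrix X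
        = P := fun P => Matrix.mvPolynomialX_mapMatrix_aeval ℤ P
  have hminor : ∀ (P : Matrix (Fin k) (Fin k) F) (m : ℕ) (r c : Fin m ↪ Fin k),
      MvPolynomial.aeval (fun p : Fin k × Fin k => P p.1 p.2) (X.submatrix r c).det =
        (P.submatrix r c).det := by
    intro P m r c
    conv_rhs => rw [← hX P]
    exact RingHom.map_det
      ((MvPolynomial.aeval fun p : Fin k × Fin k => P p.1 p.2 :
        MvPolynomial (Fin k × Fin k) ℤ →ₐ[ℤ] F) : MvPolynomial (Fin k × Fin k) ℤ →+* F) _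
  have hrep : ∀ (P : Matrix (Fin k) (Fin k) F) (S T : Finset (Fin k)),
      MvPolynomial.aeval (fun p : Fin k × Fin k => P p.1 p.2) (repairDet S T X) =
        repairDet S T P := by
    intro P S T
    conv_rhs => rw [← hX P]
    exact map_repairDet
      ((MvPolynomial.aeval fun p : Fin k × Fin k => P p.1 p.2 :
        MvPolynomial (Fin k × Fin k) ℤ →ₐ[ℤ] F) : MvPolynomial (Fin k × Fin k) ℤ →+* F) S T X
  obtain ⟨x, hx⟩ := hq F hF (by
    rintro (⟨m, r, c⟩ | ⟨⟨S, T⟩, hST⟩)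
    -- A permutation carrying the chosen rows to the chosen columns makes this submatrix the
    -- identity.
    · obtain ⟨σ, hσ⟩ := Equiv.Perm.exists_extending_pair r c r.injective c.injective
      refine ⟨fun p => σ.permMatrix F p.1 p.2, ?_⟩
      have : (σ.permMatrix F).submatrix r c = 1 := by
        ext a b
        rw [Matrix.submatrix_apply, permMatrix_apply, hσ,
          Matrix.one_apply]
        simp
      rw [show Φ (Sum.inl ⟨m, r, c⟩) = (X.submatrix r c).det from rfl, hminor, this,
        Matrix.det_one]
      exact one_ne_zero
    -- The cardinality bound lets `S` be injected into the complement of `T`.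
    · have hcard : Fintype.card S ≤ Fintype.card (Tᶜ : Finset (Fin k)) := by
        rw [Fintype.card_coe, Fintype.card_coe, Finset.card_compl, Fintype.card_fin]
        exact Nat.le_sub_of_add_le hST
      obtain ⟨f⟩ := Function.Embedding.nonempty_of_card_le hcard
      obtain ⟨σ, hσ⟩ := Equiv.Perm.exists_extending_pair (fun i : S => (i : Fin k))
        (fun i => (f i : Fin k)) Subtype.val_injective
        (Subtype.val_injective.comp f.injective)
      refine ⟨fun p => σ.permMatrix F p.1 p.2, ?_⟩
      rw [show Φ (Sum.inr ⟨(S, T), hST⟩) = repairDet S T X from rfl, hrep]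
      refine repairDet_permMatrix_ne_zero S T σ fun i hi => ?_
      rw [show σ i = f ⟨i, hi⟩ from hσ ⟨i, hi⟩]
      exact Finset.mem_compl.1 (f ⟨i, hi⟩).2)
  let P : Matrix (Fin k) (Fin k) F := Matrix.of fun i j => x (i, j)
  have hP : ∀ (m : ℕ) (r c : Fin m ↪ Fin k), (P.submatrix r c).det ≠ 0 := by
    intro m r c
    have hm : m < k + 1 := Nat.lt_succ_of_le (by simpa using Fintype.card_le_of_embedding r)
    rw [← hminor]
    exact hx (Sum.inl ⟨⟨m, hm⟩, r, c⟩)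
  refine ⟨P, fun m r c => ?_, fun S T hST => ?_⟩
  · rw [Matrix.isUnit_iff_isUnit_det, isUnit_iff_ne_zero]
    exact hP m r c
  · refine isUnit_of_repairDet_ne_zero S T P
      (hP k (Function.Embedding.refl _) (Function.Embedding.refl _)) ?_
    rw [← hrep]
    exact hx (Sum.inr ⟨(S, T), hST⟩)

/-! The algebraic core of joint repair. -/

section Repair

variable {n K : Type*} [Field K]

/-- Applying the relation twice gives `Z = c²Z`; this is the role of `κ² ≠ 1`. -/
theorem eq_zero_of_add_smul_transpose {c : K} (hc : c ^ 2 ≠ 1) {Z : Matrix n n K}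
    (h : Z + c • Zᵀ = 0) : Z = 0 := by
  have h1 : Z = -(c • Zᵀ) := eq_neg_of_add_eq_zero_left h
  have h2 : Zᵀ = -(c • Z) := by
    have := congrArg Matrix.transpose h1
    simpa using this
  have h3 : Z = (c ^ 2) • Z := by
    conv_lhs => rw [h1, h2]
    simp [smul_smul, pow_two]
  have h4 : (1 - c ^ 2) • Z = 0 := by rw [sub_smul, one_smul, ← h3, sub_self]
  exact (smul_eq_zero.1 h4).resolve_left (sub_ne_zero.2 hc.symm)

variable [Fintype n] [DecidableEq n]

theorem projections_repair {c : K} (hc : c ^ 2 ≠ 1) (hc0 : c ≠ 0) (A p r : Matrix n n K)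
    (hpT : pᵀ = p) (hpp : p * p = p) (hu : IsUnit (1 - p * r * p))
    (hAp : A * p = p * A * p) (hAr : A * r = p * A * r)
    (hMp : (A + c • Aᵀ) * p = rᵀ * (A + c • Aᵀ) * p)
    (hMr : (A + c • Aᵀ) * r = rᵀ * (A + c • Aᵀ) * r) :
    p * A = 0 ∧ rᵀ * (A + c • Aᵀ) = 0 := by
  -- Transposed form of the invertibility hypothesis, applied twice below: to `Ar - Apr` and to `Ap
  -- + c(Ap)ᵀ`.
  have hu' : ∀ X : Matrix n n K, X = p * rᵀ * p * X → X = 0 := by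
    intro X hX
    have hut : IsUnit (1 - p * rᵀ * p) := by
      have h := hu
      rw [Matrix.isUnit_iff_isUnit_det, ← Matrix.det_transpose] at h
      rw [Matrix.isUnit_iff_isUnit_det]
      simpa [Matrix.transpose_mul, hpT, Matrix.mul_assoc] using h
    refine hut.mul_left_cancel ?_
    rw [Matrix.sub_mul, Matrix.one_mul, ← hX, sub_self, Matrix.mul_zero]
  have hpAt : p * Aᵀ = p * Aᵀ * p := by
    simpa [Matrix.transpose_mul, hpT, Matrix.mul_assoc] using congrArg Matrix.transpose hAp
  have hrAt : rᵀ * Aᵀ = rᵀ * Aᵀ * p := by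
    simpa [Matrix.transpose_mul, hpT, Matrix.mul_assoc] using congrArg Matrix.transpose hAr
  have e1 : A * p + c • (Aᵀ * p) = rᵀ * A * p + c • (rᵀ * Aᵀ * p) := by
    simpa [Matrix.add_mul, Matrix.mul_add] using hMp
  have e2 : A * r + c • (Aᵀ * r) = rᵀ * A * r + c • (rᵀ * Aᵀ * r) := by
    simpa [Matrix.add_mul, Matrix.mul_add] using hMr
  have f1 : p * A * p * r + c • (p * Aᵀ * p * r) =
      p * rᵀ * A * p * r + c • (p * rᵀ * Aᵀ * p * r) := by
    simpa [Matrix.add_mul, Matrix.mul_add, Matrix.mul_assoc]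
      using congrArg (fun X => p * X * r) e1
  have f2 : p * A * r + c • (p * Aᵀ * r) = p * rᵀ * A * r + c • (p * rᵀ * Aᵀ * r) := by
    simpa [Matrix.add_mul, Matrix.mul_add, Matrix.mul_assoc]
      using congrArg (fun X => p * X) e2
  have g2 : p * rᵀ * Aᵀ * p * r = p * rᵀ * Aᵀ * r := by
    rw [Matrix.mul_assoc p rᵀ, hrAt]
    simp only [Matrix.mul_assoc]
    rw [← Matrix.mul_assoc p p r, hpp]
  rw [← hpAt, g2, ← hAp] at f1
  rw [← hAr] at f2
  -- In `f2 - f1` the terms with `Aᵀ` cancel, since `pAᵀ` and `rᵀAᵀ` absorb `p` on the right.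
  have hD : A * r - A * p * r = 0 := by
    apply hu'
    have hd : A * r - A * p * r = p * rᵀ * A * r - p * rᵀ * A * p * r := by
      have := congrArg₂ (fun X Y => X - Y) f2 f1
      simpa using this
    refine hd.trans ?_
    conv_lhs => rw [Matrix.mul_assoc _ A r, hAr, Matrix.mul_assoc _ A p, hAp]
    simp only [Matrix.mul_sub, Matrix.mul_assoc]
  have hArp : A * r = A * p * r := sub_eq_zero.1 hD
  have hrA : rᵀ * Aᵀ = rᵀ * p * Aᵀ := by
    simpa [Matrix.transpose_mul, hpT, Matrix.mul_assoc] using congrArg Matrix.transpose hArp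
  have hZ : A * p + c • (A * p)ᵀ = 0 := by
    have hY : A * p + c • (p * Aᵀ) = p * rᵀ * A * p + c • (p * rᵀ * p * Aᵀ * p) := by
      have := congrArg (fun X => p * X) e1
      simp only [Matrix.mul_add, Matrix.mul_smul] at this
      rw [hrA, ← Matrix.mul_assoc, ← hAp, ← Matrix.mul_assoc, ← hpAt] at this
      simpa [Matrix.mul_assoc] using this
    rw [Matrix.transpose_mul, hpT]
    apply hu'
    refine hY.trans ?_
    have t1 : p * rᵀ * A * p = p * rᵀ * p * (A * p) := by
      conv_lhs => rw [Matrix.mul_assoc _ A p, hAp]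
      simp only [Matrix.mul_assoc]
    have t2 : p * rᵀ * p * Aᵀ * p = p * rᵀ * p * (p * Aᵀ) := by
      rw [hpAt]
      simp only [Matrix.mul_assoc]
      rw [← Matrix.mul_assoc p p, hpp]
    rw [t1, t2, Matrix.mul_add, Matrix.mul_smul]
  have hAp0 : A * p = 0 := eq_zero_of_add_smul_transpose hc hZ
  have hAr0 : A * r = 0 := by rw [hArp, hAp0, Matrix.zero_mul]
  have hrAt0 : rᵀ * Aᵀ = 0 := by rw [← Matrix.transpose_mul, hAr0, Matrix.transpose_zero]
  have hAtp : Aᵀ * p = 0 := by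
    rw [Matrix.mul_assoc rᵀ A p, hAp0, hrAt0] at e1
    simpa [hc0] using e1
  have hpA : p * A = 0 := by
    simpa [Matrix.transpose_mul, hpT] using congrArg Matrix.transpose hAtp
  refine ⟨hpA, ?_⟩
  have hAtr : Aᵀ * r = 0 := by
    rw [Matrix.mul_assoc rᵀ A r, hAr0, hrAt0] at e2
    simpa [hc0] using e2
  have hrA0 : rᵀ * A = 0 := by
    simpa [Matrix.transpose_mul] using congrArg Matrix.transpose hAtr
  rw [Matrix.mul_add, hrA0, Matrix.mul_smul, hrAt0, smul_zero, add_zero]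

/-- Vanishing outside a set of rows is invariance under a coordinate projection; cancelling `Pᵀ` and
multiplying by `P⁻¹` puts this in the form of `projections_repair`. -/
theorem joint_repair {c : K} (hc : c ^ 2 ≠ 1) (hc0 : c ≠ 0) (A P : Matrix n n K)
    (hP : IsUnit P.det) (S T : Finset n)
    (hu : IsUnit (1 - coordProj K S * P * coordProj K T * P⁻¹ * coordProj K S))
    (h₁ : ∀ j ∉ S, ∀ l ∈ S, A j l = 0) (h₂ : ∀ j ∉ S, ∀ i ∈ T, (A * P) j i = 0)
    (h₃ : ∀ j ∉ T, ∀ l ∈ S, (Pᵀ * (A + c • Aᵀ)) j l = 0)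
    (h₄ : ∀ j ∉ T, ∀ i ∈ T, (Pᵀ * (A + c • Aᵀ) * P) j i = 0) :
    (∀ l ∈ S, ∀ j, A l j = 0) ∧ ∀ i ∈ T, ∀ j, (Pᵀ * (A + c • Aᵀ)) i j = 0 := by
  have key : ∀ (X : Matrix n n K) (S T : Finset n), (∀ i ∉ S, ∀ j ∈ T, X i j = 0) →
      X * coordProj K T = coordProj K S * X * coordProj K T := by
    intro X S T h
    ext i j
    rw [mul_coordProj_apply, mul_coordProj_apply, coordProj_mul_apply]
    by_cases hj : j ∈ T <;> by_cases hi : i ∈ S <;> simp [hi, hj, h]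
  have hPT : (P⁻¹)ᵀ * Pᵀ = 1 := by
    rw [← Matrix.transpose_mul, Matrix.mul_nonsing_inv P hP, Matrix.transpose_one]
  have hPT' : Pᵀ * (P⁻¹)ᵀ = 1 := by
    rw [← Matrix.transpose_mul, Matrix.nonsing_inv_mul P hP, Matrix.transpose_one]
  have hrT : (P * coordProj K T * P⁻¹)ᵀ = (P⁻¹)ᵀ * coordProj K T * Pᵀ := by
    simp [Matrix.transpose_mul, coordProj_transpose, Matrix.mul_assoc]
  have key' : ∀ X Y : Matrix n n K, Pᵀ * X * Y = coordProj K T * (Pᵀ * X) * Y →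
      X * Y = (P * coordProj K T * P⁻¹)ᵀ * X * Y := by
    intro X Y h
    have h' := congrArg (fun Z => (P⁻¹)ᵀ * Z) h
    simp only [Matrix.mul_assoc] at h'
    rw [← Matrix.mul_assoc, hPT, Matrix.one_mul] at h'
    rw [hrT]
    simpa only [Matrix.mul_assoc] using h'
  obtain ⟨hpA, hrM⟩ := projections_repair hc hc0 A (coordProj K S) (P * coordProj K T * P⁻¹)
    (coordProj_transpose S) (coordProj_mul_self S) (by simpa only [Matrix.mul_assoc] using hu)
    (key A S S h₁)
    (by simpa only [Matrix.mul_assoc] using congrArg (fun X => X * P⁻¹) (key (A * P) S T h₂))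
    (key' _ _ (key _ T S h₃))
    (key' _ _ (by
      simpa only [Matrix.mul_assoc] using congrArg (fun X => X * P⁻¹) (key _ T T h₄)))
  refine ⟨fun l hl j => ?_, fun i hi j => ?_⟩
  · have := congrFun (congrFun hpA l) j
    rwa [coordProj_mul_apply, if_pos hl] at this
  · have h5 : coordProj K T * (Pᵀ * (A + c • Aᵀ)) = 0 := by
      have h6 := congrArg (fun X => Pᵀ * X) hrM
      rw [hrT] at h6
      simp only [Matrix.mul_assoc, Matrix.mul_zero] at h6
      rwa [← Matrix.mul_assoc, hPT', Matrix.one_mul] at h6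
    have := congrFun (congrFun h5 i) j
    rwa [coordProj_mul_apply, if_pos hi] at this

end Repair

/-! The minimum storage point for `d = 2k - e`. -/

section Point

theorem sum_get_mul (u : List ℕ) (α : ℝ) :
    ∑ i : Fin u.length, (u.get i : ℝ) * α = (u.sum : ℝ) * α := by
  rw [← Finset.sum_mul, ← Nat.cast_sum]
  congr 2
  exact Fin.sum_univ_getElem u

theorem scenarioCut_le (d : ℕ) (α β : ℝ) (u : List ℕ) :
    scenarioCut d α β u ≤ (u.sum : ℝ) * α := by
  rw [← sum_get_mul]
  exact Finset.sum_le_sum fun i _ => min_le_left _ _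

theorem scenarioCut_le_of_index (d : ℕ) (α β : ℝ) (u : List ℕ) (i : Fin u.length) :
    scenarioCut d α β u ≤
      (u.sum : ℝ) * α - (u.get i : ℝ) * α + ((d : ℝ) - ((u.take i).sum : ℝ)) * β := by
  rw [← sum_get_mul, ← Finset.add_sum_erase _ _ (Finset.mem_univ i), scenarioCut,
    ← Finset.add_sum_erase _ _ (Finset.mem_univ i), add_sub_cancel_left, add_comm]
  exact add_le_add (Finset.sum_le_sum fun j _ => min_le_left _ _) (min_le_right _ _)

theorem take_sum_add_get_le_sum (u : List ℕ) (i : Fin u.length) :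
    (u.take i).sum + u.get i ≤ u.sum := by
  have h : (u.take (i + 1)).sum = (u.take i).sum + u.get i := by
    rw [List.sum_take_succ u i i.2]
    rfl
  rw [← h]
  conv_rhs => rw [← List.take_append_drop (i + 1) u, List.sum_append]
  exact Nat.le_add_right _ _

theorem functionalFeasible_minimum_storage {k e : ℕ} (hek : e ≤ k) :
    FunctionalFeasible ((k : ℝ) * k) k (2 * k - e) e k e := by
  refine ⟨Nat.cast_nonneg _, Nat.cast_nonneg _, fun u hu => ?_⟩
  have h0 : (k : ℝ) * k = ∑ i : Fin u.length, (u.get i : ℝ) * k := by rw [sum_get_mul, hu.2]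
  rw [h0]
  refine Finset.sum_le_sum fun i _ => le_min le_rfl ?_
  have h1 : ((u.take i).sum : ℝ) + (u.get i : ℝ) ≤ k := by
    have := take_sum_add_get_le_sum u i
    rw [hu.2] at this
    exact_mod_cast this
  have h2 : (u.get i : ℝ) ≤ e := by exact_mod_cast (hu.1 _ (List.get_mem u i)).2
  have h3 : (e : ℝ) ≤ k := by exact_mod_cast hek
  rw [Nat.cast_sub (by omega), Nat.cast_mul, Nat.cast_two]
  -- With `s` the earlier sum, the slack `(2k-e-s)e - uk` equals `(k-e)(e-u) + e(k-s-u)`.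
  nlinarith [mul_nonneg (sub_nonneg.2 h3) (sub_nonneg.2 h2),
    mul_nonneg (Nat.cast_nonneg (α := ℝ) e) (sub_nonneg.2 h1)]

theorem isMSMRPoint_minimum_storage {k e : ℕ} (he : 1 ≤ e) (hek : e ≤ k) :
    IsMSMRPoint ((k : ℝ) * k) k (2 * k - e) e k e := by
  have hk : (0 : ℝ) < k := by exact_mod_cast lt_of_lt_of_le he hek
  refine ⟨⟨⟨e, functionalFeasible_minimum_storage hek⟩, ?_⟩,
    functionalFeasible_minimum_storage hek, ?_⟩
  · rintro a ⟨b, -, -, hab⟩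
    have h := (hab (List.replicate k 1) ⟨fun x hx => ?_, by simp⟩).trans (scenarioCut_le _ _ _ _)
    · rw [List.sum_replicate, smul_eq_mul, mul_one] at h
      exact le_of_mul_le_mul_left h hk
    · rw [List.eq_of_mem_replicate hx]
      exact ⟨le_rfl, he⟩
  · rintro b ⟨-, -, hb⟩
    -- Bounding the last term by bandwidth gives `k² ≤ (k-e)k + kb`, hence `b ≥ e`.
    have hsum : (List.replicate (k - e) 1 ++ [e]).sum = k := by simp [hek]
    have hlen : k - e < (List.replicate (k - e) 1 ++ [e]).length := by simp
    have h := (hb (List.replicate (k - e) 1 ++ [e]) ⟨fun x hx => ?_, hsum⟩).trans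
      (scenarioCut_le_of_index _ _ _ _ ⟨k - e, hlen⟩)
    · have hget : (List.replicate (k - e) 1 ++ [e]).get ⟨k - e, hlen⟩ = e := by simp
      have htake : ((List.replicate (k - e) 1 ++ [e]).take (k - e)).sum = k - e := by simp
      rw [hsum, hget, htake, Nat.cast_sub hek, Nat.cast_sub (by omega : e ≤ 2 * k)] at h
      push_cast at h
      have h' : (k : ℝ) * e ≤ k * b := by linarith
      exact le_of_mul_le_mul_left h' hk
    · rcases List.mem_append.1 hx with hx | hx
      · rw [List.eq_of_mem_replicate hx]
        exact ⟨le_rfl, he⟩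
      · rw [List.mem_singleton.1 hx]
        exact ⟨he, le_rfl⟩

end Point

/-! Interference alignment codes with `V = 1`. -/

namespace IACode

variable {k : ℕ} {F : Type*} [Field F] (D : IACode k F)

theorem node_inr_apply (hV : D.V = 1) (i l : Fin k) (w : Fin k → Fin k → F) :
    D.node (Sum.inr i) w l =
      (D.Pᵀ * (Matrix.of w + D.κ⁻¹ • (Matrix.of w)ᵀ)) i l := by
  simp only [node, LinearMap.sum_apply, Finset.sum_apply, LinearMap.comp_apply,
    LinearMap.proj_apply, Matrix.vecMulLinear_apply, Matrix.vecMul, dotProduct, G, U, dualV, hV,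
    Matrix.add_apply, Matrix.vecMulVec_apply, Matrix.smul_apply, Matrix.mul_apply,
    Matrix.transpose_apply, Matrix.of_apply, inv_one, Matrix.transpose_one, Matrix.one_mul,
    smul_eq_mul, mul_add, Finset.sum_add_distrib]
  rw [add_comm]
  congr 1
  · refine Finset.sum_congr rfl fun j _ => ?_
    simp [Matrix.one_apply, mul_comm]
  · rw [Finset.sum_eq_single l]
    · refine Finset.sum_congr rfl fun j _ => ?_
      simp
      ring
    · intro j _ hj
      simp [Matrix.one_apply_ne hj.symm]
    · simp

theorem repairVector_inl (hV : D.V = 1) (l : Fin k) :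
    D.repairVector (Sum.inl l) = Pi.single l 1 := by
  ext a
  simp [repairVector, dualV, hV, Matrix.one_apply, Pi.single_apply, eq_comm]

theorem repairVector_inr (hV : D.V = 1) (l a : Fin k) :
    D.repairVector (Sum.inr l) a = D.κ⁻¹ * D.P a l := by
  simp [repairVector, U, dualV, hV]

/-- The joint repair condition on `P`, for failed systematic nodes `S` and parity nodes `T`. -/
def RepairCondition (S T : Finset (Fin k)) : Prop :=
  IsUnit (1 - coordProj F S * D.P * coordProj F T * D.P⁻¹ * coordProj F S)

theorem node_eq_zero_of_repairSymbol_eq_zero (hV : D.V = 1) (E : Finset (Fin k ⊕ Fin k))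
    (hE : D.RepairCondition E.toLeft E.toRight) (w : Fin k → Fin k → F)
    (hw : ∀ h ∉ E, ∀ f ∈ E, D.repairSymbol h f w = 0) : ∀ f ∈ E, D.node f w = 0 := by
  have hP : IsUnit D.P.det := (Matrix.isUnit_iff_isUnit_det _).1
    (D.submatrix_P k (Function.Embedding.refl _) (Function.Embedding.refl _))
  have hc0 : D.κ⁻¹ ≠ 0 := inv_ne_zero D.κ_ne_zero
  have hc : D.κ⁻¹ ^ 2 ≠ 1 := by
    rw [inv_pow, Ne, inv_eq_one]
    exact sub_ne_zero.1 D.κ_sq_sub_one_ne_zero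
  have hinr : ∀ x : Fin k → F, ∀ i, x ⬝ᵥ D.repairVector (Sum.inr i) = 0 →
      ∑ a, x a * D.P a i = 0 := by
    intro x i hx
    refine (mul_eq_zero.1 (Eq.trans ?_ hx)).resolve_left hc0
    rw [dotProduct, Finset.mul_sum]
    refine Finset.sum_congr rfl fun a _ => ?_
    rw [D.repairVector_inr hV]
    ring
  obtain ⟨hl, hr⟩ := joint_repair hc hc0 (Matrix.of w) D.P hP E.toLeft E.toRight hE
    (fun j hj l hl => by
      have := hw _ (mt Finset.mem_toLeft.2 hj) _ (Finset.mem_toLeft.1 hl)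
      rwa [repairSymbol, D.repairVector_inl hV, dotProduct_single_one] at this)
    (fun j hj i hi => hinr _ _ (hw _ (mt Finset.mem_toLeft.2 hj) _ (Finset.mem_toRight.1 hi)))
    (fun j hj l hl => by
      have := hw _ (mt Finset.mem_toRight.2 hj) _ (Finset.mem_toLeft.1 hl)
      rwa [repairSymbol, D.repairVector_inl hV, dotProduct_single_one,
        D.node_inr_apply hV] at this)
    (fun j hj i hi => by
      have := hinr _ _ (hw _ (mt Finset.mem_toRight.2 hj) _ (Finset.mem_toRight.1 hi))
      simpa only [D.node_inr_apply hV, ← Matrix.mul_apply] using this)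
  rintro (l | i) hf
  · exact funext fun j => hl l (Finset.mem_toLeft.2 hf) j
  · exact funext fun j => (D.node_inr_apply hV i j w).trans (hr i (Finset.mem_toRight.2 hf) j)

theorem repairsFromSingleNodeSymbols (hV : D.V = 1) (E : Finset (Fin k ⊕ Fin k))
    (hE : D.RepairCondition E.toLeft E.toRight) : D.RepairsFromSingleNodeSymbols E := by
  let sent : (Fin k → Fin k → F) →ₗ[F] ({h // h ∉ E} → {f // f ∈ E} → F) :=
    { toFun := fun w h f => D.repairSymbol h.1 f.1 w
      map_add' := fun v w => by
        ext h f
        simp [repairSymbol, add_dotProduct]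
      map_smul' := fun c w => by
        ext h f
        simp [repairSymbol, smul_dotProduct] }
  refine exists_linearMap_factor sent
    (LinearMap.pi fun f : {f // f ∈ E} => D.node f.1) fun w hw => ?_
  refine funext fun f => D.node_eq_zero_of_repairSymbol_eq_zero hV E hE w ?_ f.1 f.2
  exact fun h hh g hg => congrFun (congrFun hw ⟨h, hh⟩) ⟨g, hg⟩

theorem hasReconstruction (hV : D.V = 1)
    (hD : ∀ S T : Finset (Fin k), S.card + T.card ≤ k → D.RepairCondition S T) :
    HasReconstruction D.node k := by
  intro S hS
  refine exists_linearMap_factor (LinearMap.pi fun i : {i // i ∈ S} => D.node i.1)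
    LinearMap.id fun w hw => ?_
  have hS0 : ∀ f ∈ S, D.node f w = 0 := fun f hf => congrFun hw ⟨f, hf⟩
  have hcard : Sᶜ.toLeft.card + Sᶜ.toRight.card ≤ k := by
    rw [Finset.card_toLeft_add_card_toRight, Finset.card_compl, Fintype.card_sum,
      Fintype.card_fin, hS, Nat.add_sub_cancel]
  have hall : ∀ f, D.node f w = 0 := fun f => by
    by_cases hf : f ∈ S
    · exact hS0 f hf
    -- The other `k` nodes count as failed; the surviving contents are zero, so all their symbols
    -- are too.
    · refine D.node_eq_zero_of_repairSymbol_eq_zero hV Sᶜ (hD _ _ hcard) w (fun h hh g _ => ?_) f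
        (Finset.mem_compl.2 hf)
      rw [repairSymbol, hS0 h (by simpa using hh), zero_dotProduct]
  exact funext fun l => hall (Sum.inl l)

theorem exactRepair_of_repairsFromSingleNodeSymbols (E H : Finset (Fin k ⊕ Fin k))
    (hEH : ∀ h, h ∉ E → h ∈ H) (hE : D.RepairsFromSingleNodeSymbols E) :
    ExactRepair D.node E H E.card := by
  obtain ⟨rep, hrep⟩ := hE
  let idx : {f // f ∈ E} ≃ Fin E.card := E.equivFin
  let select : ({h // h ∈ H} → Fin E.card → F) →ₗ[F] ({h // h ∉ E} → {f // f ∈ E} → F) :=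
    { toFun := fun y h f => y ⟨h.1, hEH h.1 h.2⟩ (idx f)
      map_add' := fun _ _ => rfl
      map_smul' := fun _ _ => rfl }
  refine ⟨fun _ =>
    { toFun := fun x b => x ⬝ᵥ D.repairVector (idx.symm b).1
      map_add' := fun x y => funext fun b => add_dotProduct _ _ _
      map_smul' := fun c x => funext fun b => smul_dotProduct _ _ _ },
    rep.comp select, fun w => ?_⟩
  rw [← hrep w]
  refine congrArg rep (funext fun h => funext fun f => ?_)
  simp [select, repairSymbol]

theorem isMSMRCode (hV : D.V = 1)
    (hD : ∀ S T : Finset (Fin k), S.card + T.card ≤ k → D.RepairCondition S T) {e : ℕ}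
    (he : 1 ≤ e) (hek : e ≤ k) : IsMSMRCode (2 * k) k (2 * k - e) e k e D.node where
  card_nodes := by rw [Fintype.card_sum, Fintype.card_fin, two_mul]
  k_le_d := by omega
  d_add_e_le := by omega
  reconstruction := D.hasReconstruction hV hD
  regeneration := by
    rintro E H rfl hH hdisj
    -- Since `d + e = 2k`, every survivor is a helper.
    have hHE : H = Eᶜ := by
      refine Finset.eq_of_subset_of_card_le
        (Finset.subset_compl_iff_disjoint_left.2 hdisj) ?_
      rw [Finset.card_compl, Fintype.card_sum, Fintype.card_fin, hH, two_mul]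
    refine D.exactRepair_of_repairsFromSingleNodeSymbols E H
      (fun h hh => hHE ▸ Finset.mem_compl.2 hh)
      (D.repairsFromSingleNodeSymbols hV E (hD _ _ ?_))
    rwa [Finset.card_toLeft_add_card_toRight]
  msmr_point := by
    have hrank : (Module.finrank F (Fin k → Fin k → F) : ℝ) = (k : ℝ) * k := by
      rw [Module.finrank_pi_fintype]
      simp
    rw [hrank]
    exact isMSMRPoint_minimum_storage he hek

end IACode

theorem exists_ne_zero_sq_ne_one (F : Type*) [Field F] [Finite F] (hF : 4 ≤ Nat.card F) :
    ∃ x : F, x ≠ 0 ∧ x ^ 2 - 1 ≠ 0 := by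
  classical
  have := Fintype.ofFinite F
  have hcard : ({0, 1, -1} : Finset F).card < (Finset.univ : Finset F).card := by
    rw [Finset.card_univ, ← Nat.card_eq_fintype_card]
    exact lt_of_le_of_lt Finset.card_le_three hF
  obtain ⟨x, -, hx⟩ := Finset.exists_mem_notMem_of_card_lt_card hcard
  simp only [Finset.mem_insert, Finset.mem_singleton, not_or] at hx
  refine ⟨x, hx.1, fun h => ?_⟩
  rcases sq_eq_sq_iff_eq_or_eq_neg.1 ((sub_eq_zero.1 h).trans (one_pow 2).symm) with h | h
  exacts [hx.2.1 h, hx.2.2 h]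

end RegeneratingCode

theorem mainTheorem9 (k : ℕ) :
    ∃ q₀ : ℕ, ∀ (F : Type*) [Field F] [Finite F], q₀ ≤ Nat.card F →
      ∃ D : RegeneratingCode.IACode k F, ∀ e : ℕ, 1 ≤ e → e ≤ k →
        RegeneratingCode.IsMSMRCode (2 * k) k (2 * k - e) e k e D.node ∧
          ∀ E : Finset (Fin k ⊕ Fin k), E.card = e → D.RepairsFromSingleNodeSymbols E := by
  obtain ⟨q₀, hq⟩ := RegeneratingCode.exists_generic_matrix k
  refine ⟨max q₀ 4, fun F _ _ hF => ?_⟩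
  obtain ⟨P, hminor, hP⟩ := hq F ((le_max_left _ _).trans hF)
  obtain ⟨κ, hκ, hκ2⟩ :=
    RegeneratingCode.exists_ne_zero_sq_ne_one F ((le_max_right _ _).trans hF)
  let D : RegeneratingCode.IACode k F :=
    { V := 1
      P := P
      κ := κ
      linearIndependent_V := by
        rw [Matrix.transpose_one]
        exact Matrix.linearIndependent_rows_of_isUnit isUnit_one
      submatrix_P := hminor
      κ_ne_zero := hκ
      κ_sq_sub_one_ne_zero := hκ2 }
  refine ⟨D, fun e he hek => ⟨D.isMSMRCode rfl hP he hek, fun E hE =>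
    D.repairsFromSingleNodeSymbols rfl E (hP _ _ ?_)⟩⟩
  rwa [Finset.card_toLeft_add_card_toRight, hE]
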